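/- Let $(\mathcal X,\rho)$ be a complete separable metric space with its Borel $\sigma$-field, let $T=[0,\infty)$ or $T=\{0,1,2,\dots\}$, and let $\{P_t\}_{t\in T}$ be a Markov–Feller semigroup on $\mathcal X$: a family of Markov transition kernels $P_t(x,\cdot)$ with $P_0(x,\cdot)=\delta_x$ and $P_{s+t}(x,\cdot)=\int_{\mathcal X}P_s(y,\cdot)\,P_t(x,dy)$ for all $s,t\in T$, such that $P_tf(x)=\int_{\mathcal X} f(y)\,P_t(x,dy)$ is continuous in $x$ for every bounded continuous $f:\mathcal X\to\mathbb R$ and $t\in T$. For a probability measure $\nu$ put $P_t\nu(B)=\int_{\mathcal X} P_t(x,B)\,\nu(dx)$; $\nu$ is invariant if $P_t\nu=\nu$ for all $t\in T$. Let $B(z,\varepsilon)$ be the open ball, and $\operatorname{supp}\mu=\{x:\mu(B(x,\varepsilon))>0\text{ for every }\varepsilon>0\}$. The semigroup is asymptotically stable with invariant measure $\mu$ if $\mu$ is its unique invariant probability measure and $P_t\nu$ converges weakly to $\mu$ as $t\to\infty$ for every probability measure $\nu$. It is eventually continuous on $\mathcal X$ if for every $z\in\mathcal X$ and every bounded Lipschitz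 function $f:\mathcal X\to\mathbb R$, $$\lim_{x\to z}\limsup_{t\to\infty}|P_tf(x)-P_tf(z)|=0 .$$ For $z\in\mathcal X$ and $\varepsilon>0$ consider the condition $$\inf_{x\in\mathcal X}\liminf_{t\to\infty}P_t(x,B(z,\varepsilon))>0. \tag{1}$$ Theorem. The following three statements are equivalent. (i) $\{P_t\}_{t\in T}$ is asymptotically stable with invariant measure $\mu$, for some probability measure $\mu$. (ii) $\{P_t\}_{t\in T}$ is eventually continuous on $\mathcal X$ and has an invariant probability measure $\mu$ such that (1) holds for all $z\in\operatorname{supp}\mu$ and all $\varepsilon>0$. (iii) $\{P_t\}_{t\in T}$ is eventually continuous on $\mathcal X$ and there is a point $z\in\mathcal X$ such that (1) holds for all $\varepsilon>0$. Moreover, (i) and (ii) are equivalent for each given $\mu$: the semigroup is asymptotically stable with invariant measure $\mu$ if and only if it is eventually continuous on $\mathcal X$, $\mu$ is an invariant probability measure, and (1) holds for all $z\in\operatorname{supp}\mu$ and all $\varepsilon>0$. -/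

import Mathlib

open MeasureTheory ProbabilityTheory Filter Topology
open scoped NNReal ENNReal BoundedContinuousFunction

/-- A Markov-Feller semigroup on `X` with time set `T`, given by its transition probabilities
`P_t(x, ·)`: Markov kernels with `P_0 = Id` and the Chapman-Kolmogorov equation
`P_{s+t} = P_s P_t`, such that `x ↦ P_t f(x) = ∫ f(y) P_t(x, dy)` is continuous for every bounded
continuous `f`. No regularity in time is required. -/
structure MarkovFellerSemigroup (T X : Type*) [AddMonoid T] [TopologicalSpace X]
    [MeasurableSpace X] where
  /-- the transition probabilities: `kernel t x` is `P_t(x, ·)` -/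
  kernel : T → Kernel X X
  isMarkovKernel (t : T) : IsMarkovKernel (kernel t)
  kernel_zero : kernel 0 = Kernel.id
  kernel_add (s t : T) : kernel (s + t) = kernel s ∘ₖ kernel t
  feller (t : T) (f : X →ᵇ ℝ) : Continuous fun x => ∫ y, f y ∂(kernel t x)

namespace MarkovFellerSemigroup

attribute [instance] MarkovFellerSemigroup.isMarkovKernel

variable {T X : Type*} [AddMonoid T]

section Topological

variable [TopologicalSpace X] [MeasurableSpace X]

/-- The action on functions, `P_t f(x) = ∫ f(y) P_t(x, dy)`. -/
noncomputable def apply (P : MarkovFellerSemigroup T X) (t : T) (f : X → ℝ) (x : X) : ℝ :=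
  ∫ y, f y ∂(P.kernel t x)

/-- The dual action on probability measures, `P_t ν(B) = ∫ P_t(x, B) ν(dx)`. -/
noncomputable def dual (P : MarkovFellerSemigroup T X) (t : T) (ν : ProbabilityMeasure X) :
    ProbabilityMeasure X :=
  ⟨(ν : Measure X).bind (P.kernel t), inferInstance⟩

/-- `μ` is an invariant probability measure of the semigroup. -/
def IsInvariant (P : MarkovFellerSemigroup T X) (μ : ProbabilityMeasure X) : Prop :=
  ∀ t : T, P.dual t μ = μ

/-- The semigroup is asymptotically stable with unique invariant probability measure `μ`:
`P_t ν` converges weakly to `μ` as `t → ∞`, for every probability measure `ν`. -/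
def IsAsymptoticallyStableWith [Preorder T] [OpensMeasurableSpace X]
    (P : MarkovFellerSemigroup T X) (μ : ProbabilityMeasure X) : Prop :=
  P.IsInvariant μ ∧ (∀ μ' : ProbabilityMeasure X, P.IsInvariant μ' → μ' = μ) ∧
    ∀ ν : ProbabilityMeasure X, Tendsto (fun t => P.dual t ν) atTop (𝓝 μ)

/-- The semigroup is asymptotically stable. -/
def IsAsymptoticallyStable [Preorder T] [OpensMeasurableSpace X]
    (P : MarkovFellerSemigroup T X) : Prop :=
  ∃ μ : ProbabilityMeasure X, P.IsAsymptoticallyStableWith μ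

end Topological

section Metric

variable [Preorder T] [MetricSpace X] [MeasurableSpace X]

/-- Eventual continuity at `z`: for every bounded Lipschitz function `f`,
`lim_{x → z} limsup_{t → ∞} |P_t f(x) - P_t f(z)| = 0`. -/
def EventuallyContinuousAt (P : MarkovFellerSemigroup T X) (z : X) : Prop :=
  ∀ f : X →ᵇ ℝ, (∃ K : ℝ≥0, LipschitzWith K f) →
    Tendsto (fun x => limsup (fun t => |P.apply t f x - P.apply t f z|) atTop) (𝓝 z) (𝓝 0)

/-- Eventual continuity on the whole space. -/
def EventuallyContinuous (P : MarkovFellerSemigroup T X) : Prop :=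
  ∀ z : X, P.EventuallyContinuousAt z

/-- The lower bound condition at `z`: for every `ε > 0`,
`inf_x liminf_{t → ∞} P_t(x, B(z, ε)) > 0`. -/
def LowerBoundAt (P : MarkovFellerSemigroup T X) (z : X) : Prop :=
  ∀ ε : ℝ, 0 < ε → 0 < ⨅ x : X, liminf (fun t => P.kernel t x (Metric.ball z ε)) atTop

end Metric

end MarkovFellerSemigroup

/-!
The content is that eventual continuity together with the lower bound at a single point `z` implies
asymptotic stability; the converse is the portmanteau theorem. Both time sets are treated at once:
all that matters is a commutative, canonically and linearly ordered monoid of times with countably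
generated `atTop`, and no measurability in time is used.

*Merging of orbits* (`MarkovFellerSemigroup.tendsto_integral_dual_sub_dual`). Fix a bounded
Lipschitz `f`. By eventual continuity, two initial distributions carried by a small ball around `z`
have orbits that `f` eventually separates by at most a small `e`. By the lower bound, any
distribution at some time puts mass at least `γ` on this ball, with `γ` independent of the
distribution. Hence a bound `c` valid for all pairs of distributions improves to
`γ e + (1 - γ) c`, and iteration gives bounds as close to `e` as desired. So
`∫ f d(P_t ν₁) - ∫ f d(P_t ν₂) → 0` for all `ν₁`, `ν₂`. Once an invariant measure exists, taking it
for `ν₂` gives its stability and uniqueness.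

*Existence of an invariant measure* (`MarkovFellerSemigroup.exists_isInvariant`). By merging and
the Feller property, every weak limit point of the orbit of `z` is invariant, so by Prokhorov's
theorem tightness of the orbit along a sequence of times suffices
(`MarkovFellerSemigroup.isTightMeasureSet_range_dual`). If it fails, there are `ε > 0`, times
`q i → ∞` and `ε`-separated compact sets `K i` with `P_{q i}(z, K i) ≥ ε`. The bump functions of the
unions of the `K i` over arbitrary sets of indices are bounded and Lipschitz, so merging holds for
all of them, and a Schur-type argument
(`eventually_le_integral_bump`) shows that every point `x` sends mass `ε / 2` near `K i` at time
`q i`, for all `i` beyond some `N(x)`. By Baire's theorem on the closed set of points reachable from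
`z`, the same `N` serves all reachable points of some open set `V` that is reached from `z`. The
lower bound and the Feller property give `V` a fixed mass `γ` at all large times of the orbit of
`z`. Looking back from a late time `τ` to the times `τ - q i`, the orbit has at time `τ` mass at
least `γ ε / 2` near `K i`, for as many `i ≥ N` as desired; these neighbourhoods are disjoint, which
is absurd.
-/

/-! ### Averages of functions and splitting of probability measures -/

/-- If `|g t x| ≤ ε` for all large `t`, with a threshold depending on the point `x`, then the
`ν`-averages of `|g t|` are eventually at most any `ε' > ε`. No measurability of the threshold is
needed: the excess of `|g t|` over `ε` tends to `0` boundedly. -/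
theorem eventually_integral_abs_le {T X : Type*} [MeasurableSpace X] {l : Filter T}
    [l.IsCountablyGenerated] (ν : ProbabilityMeasure X) {g : T → X → ℝ} {C ε ε' : ℝ}
    (hg : ∀ t, Measurable (g t)) (hC : ∀ t x, |g t x| ≤ C)
    (h : ∀ᵐ x ∂(ν : Measure X), ∀ᶠ t in l, |g t x| ≤ ε) (hε : ε < ε') :
    ∀ᶠ t in l, ∫ x, |g t x| ∂(ν : Measure X) ≤ ε' := by
  have hlim : Tendsto (fun t => ∫ x, max (|g t x|) ε ∂(ν : Measure X)) l
      (𝓝 (∫ _, ε ∂(ν : Measure X))) := by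
    refine tendsto_integral_filter_of_dominated_convergence (fun _ => |C| + |ε|)
      (.of_forall fun t => ((hg t).abs.max measurable_const).aestronglyMeasurable)
      (.of_forall fun t => .of_forall fun x => ?_) (integrable_const _) ?_
    · rw [Real.norm_eq_abs, abs_le]
      have h1 := hC t x
      have h2 := le_abs_self C
      have h3 := abs_nonneg (g t x)
      have h4 := le_abs_self ε
      have h5 := abs_nonneg ε
      exact ⟨by linarith [le_max_left (|g t x|) ε], max_le (by linarith) (by linarith)⟩
    · filter_upwards [h] with x hx
      exact tendsto_const_nhds.congr' (hx.mono fun t ht => (max_eq_right ht).symm)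
  simp only [integral_const, probReal_univ, one_smul] at hlim
  filter_upwards [hlim.eventually (eventually_le_nhds hε)] with t ht
  refine le_trans (integral_mono ?_ ?_ fun x => le_max_left _ ε) ht
  · exact .of_bound (hg t).abs.aestronglyMeasurable C (.of_forall fun x => by simpa using hC t x)
  · refine .of_bound ((hg t).abs.max measurable_const).aestronglyMeasurable (max C |ε|)
      (.of_forall fun x => ?_)
    rw [Real.norm_eq_abs, abs_of_nonneg (le_max_of_le_left (abs_nonneg _))]
    exact max_le_max (hC t x) (le_abs_self ε)

/-- If `γ' ≤ g t x` for all large `t`, with a threshold depending on the point `x`, then the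
`ν`-averages of `g t` eventually exceed any `γ < γ'`. -/
theorem eventually_le_lintegral {T X : Type*} [MeasurableSpace X] {l : Filter T}
    [l.IsCountablyGenerated] (ν : ProbabilityMeasure X) {g : T → X → ℝ≥0∞} {γ γ' : ℝ≥0}
    (hg : ∀ t, Measurable (g t)) (h : ∀ x, ∀ᶠ t in l, (γ' : ℝ≥0∞) ≤ g t x) (hγ : γ < γ') :
    ∀ᶠ t in l, (γ : ℝ≥0∞) ≤ ∫⁻ x, g t x ∂(ν : Measure X) := by
  have hlim : Tendsto (fun t => ∫⁻ x, min (g t x) γ' ∂(ν : Measure X)) l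
      (𝓝 (∫⁻ _, γ' ∂(ν : Measure X))) := by
    refine tendsto_lintegral_filter_of_dominated_convergence (fun _ => γ')
      (.of_forall fun t => (hg t).min measurable_const)
      (.of_forall fun t => .of_forall fun x => min_le_right _ _) (by simp)
      (.of_forall fun x => ?_)
    exact tendsto_const_nhds.congr' ((h x).mono fun t ht => (min_eq_right ht).symm)
  simp only [lintegral_const, measure_univ, mul_one] at hlim
  filter_upwards [hlim.eventually (eventually_ge_nhds (ENNReal.coe_lt_coe.2 hγ))] with t ht
  exact ht.trans (lintegral_mono fun x => min_le_left _ _)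

/-- A probability measure giving mass at least `γ` to `B` dominates `γ` times a probability measure
carried by `B`, and the rest is `1 - γ` times a probability measure. -/
theorem MeasureTheory.ProbabilityMeasure.exists_eq_smul_add_smul {X : Type*} [MeasurableSpace X]
    (ν : ProbabilityMeasure X) {B : Set X} (hB : MeasurableSet B) {γ : ℝ≥0} (hγ0 : 0 < γ)
    (hγ1 : γ < 1) (hν : (γ : ℝ≥0∞) ≤ (ν : Measure X) B) :
    ∃ ν₁ ν₂ : ProbabilityMeasure X, (∀ᵐ x ∂(ν₁ : Measure X), x ∈ B) ∧
      (ν : Measure X) = γ • (ν₁ : Measure X) + (1 - γ) • (ν₂ : Measure X) := by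
  set p : ℝ≥0 := ν B with hp
  have hpB : (ν : Measure X) B = p := by simp [hp]
  have hγp : γ ≤ p := by rw [hpB] at hν; exact_mod_cast hν
  have hp0 : p ≠ 0 := (hγ0.trans_le hγp).ne'
  have hc : 1 - γ ≠ 0 := (tsub_pos_of_lt hγ1).ne'
  have hBc : (ν : Measure X) Bᶜ = (1 - p : ℝ≥0) := by
    rw [prob_compl_eq_one_sub hB, hpB]; simp
  have hp1 : p ≤ 1 := by
    have : (ν : Measure X) B ≤ 1 := prob_le_one
    rw [hpB] at this; exact_mod_cast this
  let m₁ : Measure X := p⁻¹ • (ν : Measure X).restrict B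
  let m₂ : Measure X := (1 - γ)⁻¹ •
    ((ν : Measure X).restrict Bᶜ + (1 - γ * p⁻¹) • (ν : Measure X).restrict B)
  have hq : γ * p⁻¹ ≤ 1 := by
    rw [← div_eq_mul_inv]; exact (div_le_one (pos_iff_ne_zero.2 hp0)).2 hγp
  have h₁ : IsProbabilityMeasure m₁ := by
    refine ⟨?_⟩
    simp only [m₁, Measure.smul_apply, ENNReal.smul_def, smul_eq_mul,
      Measure.restrict_apply_univ, hpB]
    rw [← ENNReal.coe_mul, inv_mul_cancel₀ hp0, ENNReal.coe_one]
  have h₂ : IsProbabilityMeasure m₂ := by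
    refine ⟨?_⟩
    simp only [m₂, Measure.smul_apply, ENNReal.smul_def, smul_eq_mul, Measure.add_apply,
      Measure.restrict_apply_univ, hpB, hBc]
    rw [← ENNReal.coe_mul, ← ENNReal.coe_add, ← ENNReal.coe_mul, ← ENNReal.coe_one,
      ENNReal.coe_inj]
    have : 1 - p + (1 - γ * p⁻¹) * p = 1 - γ := by
      rw [← NNReal.coe_inj]
      push_cast [NNReal.coe_sub hp1, NNReal.coe_sub hq, NNReal.coe_sub hγ1.le]
      have : (p : ℝ) ≠ 0 := by exact_mod_cast hp0
      field_simp
      ring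
    rw [this, inv_mul_cancel₀ hc]
  refine ⟨⟨m₁, h₁⟩, ⟨m₂, h₂⟩, ?_, ?_⟩
  · exact Measure.ae_smul_measure (ae_restrict_mem hB) _
  · simp only [ProbabilityMeasure.coe_mk, m₁, m₂]
    rw [smul_smul (1 - γ), mul_inv_cancel₀ hc, one_smul, smul_smul,
      add_comm ((ν : Measure X).restrict Bᶜ), ← add_assoc, ← add_smul, add_tsub_cancel_of_le hq,
      one_smul, Measure.restrict_add_restrict_compl hB]

namespace MarkovFellerSemigroup

/-! ### The action of the semigroup on functions and on measures -/

section Semigroup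

variable {T X : Type*} [AddMonoid T] [TopologicalSpace X] [MeasurableSpace X]
  (P : MarkovFellerSemigroup T X)

theorem continuous_apply (t : T) (f : X →ᵇ ℝ) : Continuous (P.apply t f) :=
  P.feller t f

theorem abs_apply_le (t : T) (f : X →ᵇ ℝ) (x : X) : |P.apply t f x| ≤ ‖f‖ := by
  have h := norm_integral_le_of_norm_le_const (μ := P.kernel t x) (f := f) (C := ‖f‖)
    (.of_forall fun y => f.norm_coe_le_norm y)
  simpa [apply] using h

theorem coe_dual (t : T) (ν : ProbabilityMeasure X) :
    (P.dual t ν : Measure X) = (ν : Measure X).bind (P.kernel t) :=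
  rfl

theorem coe_dual_diracProba (t : T) (x : X) :
    (P.dual t (diracProba x) : Measure X) = P.kernel t x :=
  Measure.dirac_bind (P.kernel t).measurable x

theorem dual_apply (t : T) (ν : ProbabilityMeasure X) {B : Set X} (hB : MeasurableSet B) :
    (P.dual t ν : Measure X) B = ∫⁻ x, P.kernel t x B ∂(ν : Measure X) := by
  simpa [dual] using Measure.bind_apply hB (P.kernel t).aemeasurable

theorem kernel_add_apply (s t : T) (x : X) {B : Set X} (hB : MeasurableSet B) :
    P.kernel (s + t) x B = ∫⁻ y, P.kernel s y B ∂(P.kernel t x) := by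
  rw [P.kernel_add, Kernel.comp_apply' _ _ _ hB]

theorem dual_add (s t : T) (ν : ProbabilityMeasure X) :
    P.dual (s + t) ν = P.dual s (P.dual t ν) := by
  apply Subtype.ext
  change (P.dual (s + t) ν : Measure X) = (P.dual s (P.dual t ν) : Measure X)
  rw [coe_dual, coe_dual, coe_dual,
    Measure.bind_bind (P.kernel t).aemeasurable (P.kernel s).aemeasurable, P.kernel_add]
  congr 1

variable [OpensMeasurableSpace X]

theorem integral_dual (t : T) (ν : ProbabilityMeasure X) (f : X →ᵇ ℝ) :
    ∫ y, f y ∂(P.dual t ν : Measure X) = ∫ x, P.apply t f x ∂(ν : Measure X) := by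
  have h : Integrable f ((P.kernel t ∘ₖ Kernel.const Unit (ν : Measure X)) ()) := f.integrable _
  simpa [Kernel.comp_apply, apply, dual] using! Kernel.integral_comp h

theorem apply_add (s t : T) (f : X →ᵇ ℝ) (x : X) :
    P.apply (s + t) f x = ∫ y, P.apply s f y ∂(P.kernel t x) := by
  have h : Integrable f ((P.kernel s ∘ₖ P.kernel t) x) := f.integrable _
  rw [apply, P.kernel_add, Kernel.integral_comp h]
  rfl

end Semigroup

end MarkovFellerSemigroup

namespace MarkovFellerSemigroup

/-! ### Merging of all orbits -/

/-- A property of all large times, translated by `t`, holds at all large times. -/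
theorem eventually_exists_eq_add {T : Type*} [AddCommMonoid T] [LinearOrder T]
    [CanonicallyOrderedAdd T] {p : T → Prop} (h : ∀ᶠ s in atTop, p s) (t : T) :
    ∀ᶠ τ in atTop, ∃ s, τ = s + t ∧ p s := by
  obtain ⟨a, ha⟩ := eventually_atTop.1 h
  filter_upwards [eventually_ge_atTop (a + t)] with τ hτ
  obtain ⟨c, rfl⟩ := le_iff_exists_add.1 hτ
  exact ⟨a + c, add_right_comm a t c, ha _ le_self_add⟩

section Merging

variable {T X : Type*} [AddMonoid T] [LinearOrder T] [MetricSpace X] [MeasurableSpace X]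
  {P : MarkovFellerSemigroup T X} {z : X}

theorem EventuallyContinuousAt.exists_forall_eventually_abs_sub_lt
    (h : P.EventuallyContinuousAt z) (f : X →ᵇ ℝ)
    (hf : ∃ K, LipschitzWith K f) {ε : ℝ} (hε : 0 < ε) :
    ∃ δ > 0, ∀ x ∈ Metric.ball z δ, ∀ᶠ t in atTop, |P.apply t f x - P.apply t f z| < ε := by
  obtain ⟨δ, hδ, H⟩ :=
    Metric.eventually_nhds_iff_ball.1 ((h f hf).eventually (eventually_lt_nhds hε))
  refine ⟨δ, hδ, fun x hx => eventually_lt_of_limsup_lt (H x hx) ?_⟩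
  refine isBoundedUnder_of ⟨‖f‖ + ‖f‖, fun t => (abs_sub _ _).trans ?_⟩
  exact add_le_add (P.abs_apply_le t f x) (P.abs_apply_le t f z)

theorem LowerBoundAt.exists_forall_eventually_le (h : P.LowerBoundAt z) {δ : ℝ} (hδ : 0 < δ) :
    ∃ γ : ℝ≥0, 0 < γ ∧ γ < 1 ∧
      ∀ x, ∀ᶠ t in atTop, (γ : ℝ≥0∞) ≤ P.kernel t x (Metric.ball z δ) := by
  obtain ⟨γ, h0, h1⟩ := ENNReal.lt_iff_exists_nnreal_btwn.1 (lt_min (h δ hδ) one_pos)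
  refine ⟨γ, by exact_mod_cast h0, by exact_mod_cast h1.trans_le (min_le_right _ _), fun x => ?_⟩
  have := h1.trans_le ((min_le_left _ _).trans (iInf_le _ x))
  exact (eventually_lt_of_lt_liminf this).mono fun t ht => ht.le

/-- The lower bound, which is uniform in the starting point, passes to initial distributions. -/
theorem LowerBoundAt.exists_forall_eventually_le_dual [BorelSpace X]
    [(atTop : Filter T).IsCountablyGenerated] (h : P.LowerBoundAt z) {δ : ℝ} (hδ : 0 < δ) :
    ∃ γ : ℝ≥0, 0 < γ ∧ γ < 1 ∧ ∀ ν : ProbabilityMeasure X, ∀ᶠ t in atTop,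
      (γ : ℝ≥0∞) ≤ (P.dual t ν : Measure X) (Metric.ball z δ) := by
  obtain ⟨γ', h0, h1, h'⟩ := h.exists_forall_eventually_le hδ
  obtain ⟨γ, hγ0, hγ⟩ := exists_between h0
  refine ⟨γ, hγ0, hγ.trans h1, fun ν => ?_⟩
  filter_upwards [eventually_le_lintegral ν
    (fun t => (P.kernel t).measurable_coe Metric.isOpen_ball.measurableSet) h' hγ] with t ht
  rwa [P.dual_apply _ _ Metric.isOpen_ball.measurableSet]

theorem eventually_abs_integral_dual_sub_le [BorelSpace X]
    [(atTop : Filter T).IsCountablyGenerated] (ν : ProbabilityMeasure X) (f : X →ᵇ ℝ) {B : Set X}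
    {ε ε' : ℝ} (hν : ∀ᵐ x ∂(ν : Measure X), x ∈ B)
    (h : ∀ x ∈ B, ∀ᶠ t in atTop, |P.apply t f x - P.apply t f z| < ε) (hε : ε < ε') :
    ∀ᶠ t in atTop, |∫ x, f x ∂(P.dual t ν : Measure X) - P.apply t f z| ≤ ε' := by
  have H := eventually_integral_abs_le (l := (atTop : Filter T)) ν
    (g := fun t x => P.apply t f x - P.apply t f z) (C := ‖f‖ + ‖f‖)
    (fun t => (P.continuous_apply t f).measurable.sub_const _)
    (fun t x => (abs_sub _ _).trans (add_le_add (P.abs_apply_le t f x) (P.abs_apply_le t f z)))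
    (hν.mono fun x hx => (h x hx).mono fun t ht => ht.le) hε
  filter_upwards [H] with t ht
  have hint : Integrable (P.apply t f) (ν : Measure X) :=
    .of_bound (P.continuous_apply t f).aestronglyMeasurable ‖f‖
      (.of_forall fun x => P.abs_apply_le t f x)
  calc |∫ x, f x ∂(P.dual t ν : Measure X) - P.apply t f z|
      = |∫ x, (P.apply t f x - P.apply t f z) ∂(ν : Measure X)| := by
        rw [P.integral_dual, integral_sub hint (integrable_const _)]; simp
    _ ≤ _ := abs_integral_le_integral_abs
    _ ≤ ε' := ht

end Merging

section Coupling

variable {T X : Type*} [AddCommMonoid T] [LinearOrder T] [CanonicallyOrderedAdd T]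
  [MetricSpace X] [MeasurableSpace X] [BorelSpace X] {P : MarkovFellerSemigroup T X} {z : X}

/-- One coupling step. Suppose that the orbits of any two initial distributions are eventually
within `c` of each other as seen by `f`, and that this holds with `e` in place of `c` when both
distributions are carried by `B`. If every distribution eventually puts mass at least `γ` on `B`,
then a proportion `γ` of the two masses can be compared at the better rate `e`. -/
theorem eventually_abs_integral_dual_sub_dual_le_step {f : X →ᵇ ℝ} {B : Set X}
    (hB : MeasurableSet B) {γ : ℝ≥0} (hγ0 : 0 < γ) (hγ1 : γ < 1)
    (hγ : ∀ ν : ProbabilityMeasure X, ∀ᶠ t in atTop, (γ : ℝ≥0∞) ≤ (P.dual t ν : Measure X) B)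
    {e c : ℝ}
    (he : ∀ ν₁ ν₂ : ProbabilityMeasure X, (∀ᵐ x ∂(ν₁ : Measure X), x ∈ B) →
      (∀ᵐ x ∂(ν₂ : Measure X), x ∈ B) → ∀ᶠ t in atTop,
        |∫ x, f x ∂(P.dual t ν₁ : Measure X) - ∫ x, f x ∂(P.dual t ν₂ : Measure X)| ≤ e)
    (hc : ∀ ν₁ ν₂ : ProbabilityMeasure X, ∀ᶠ t in atTop,
        |∫ x, f x ∂(P.dual t ν₁ : Measure X) - ∫ x, f x ∂(P.dual t ν₂ : Measure X)| ≤ c)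
    (ν₁ ν₂ : ProbabilityMeasure X) : ∀ᶠ t in atTop,
      |∫ x, f x ∂(P.dual t ν₁ : Measure X) - ∫ x, f x ∂(P.dual t ν₂ : Measure X)|
        ≤ γ * e + (1 - γ) * c := by
  -- The common factor `t₀` splits off every large time by the semigroup law.
  obtain ⟨t₀, h₁, h₂⟩ := ((hγ ν₁).and (hγ ν₂)).exists
  obtain ⟨α₁, β₁, hα₁, e₁⟩ := (P.dual t₀ ν₁).exists_eq_smul_add_smul hB hγ0 hγ1 h₁
  obtain ⟨α₂, β₂, hα₂, e₂⟩ := (P.dual t₀ ν₂).exists_eq_smul_add_smul hB hγ0 hγ1 h₂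
  have key : ∀ (ν α β : ProbabilityMeasure X),
      (P.dual t₀ ν : Measure X) = γ • (α : Measure X) + (1 - γ) • (β : Measure X) → ∀ s,
      ∫ x, f x ∂(P.dual (s + t₀) ν : Measure X) =
        γ * ∫ x, f x ∂(P.dual s α : Measure X) + (1 - γ) * ∫ x, f x ∂(P.dual s β : Measure X) := by
    intro ν α β h s
    have hint : ∀ m : ProbabilityMeasure X, Integrable (P.apply s f) (m : Measure X) := fun m =>
      .of_bound (P.continuous_apply s f).aestronglyMeasurable ‖f‖
        (.of_forall fun x => P.abs_apply_le s f x)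
    rw [P.dual_add, P.integral_dual, h,
      integral_add_measure ((hint α).smul_measure_nnreal) ((hint β).smul_measure_nnreal),
      integral_smul_nnreal_measure, integral_smul_nnreal_measure, P.integral_dual, P.integral_dual,
      NNReal.smul_def, NNReal.smul_def, NNReal.coe_sub hγ1.le]
    rfl
  filter_upwards [eventually_exists_eq_add ((he α₁ α₂ hα₁ hα₂).and (hc β₁ β₂)) t₀] with τ hτ
  obtain ⟨s, rfl, hs₁, hs₂⟩ := hτ
  rw [key _ _ _ e₁, key _ _ _ e₂]
  have hg1 : (γ : ℝ) ≤ 1 := by exact_mod_cast hγ1.le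
  rw [abs_le] at hs₁ hs₂ ⊢
  constructor <;> nlinarith [γ.coe_nonneg]

/-- Eventual continuity and the lower bound at `z` make the orbits of any two initial distributions
merge weakly. -/
theorem tendsto_integral_dual_sub_dual [(atTop : Filter T).IsCountablyGenerated]
    (hec : P.EventuallyContinuousAt z) (hlb : P.LowerBoundAt z)
    (f : X →ᵇ ℝ) (hf : ∃ K, LipschitzWith K f) (ν₁ ν₂ : ProbabilityMeasure X) :
    Tendsto (fun t => ∫ x, f x ∂(P.dual t ν₁ : Measure X) - ∫ x, f x ∂(P.dual t ν₂ : Measure X))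
      atTop (𝓝 0) := by
  rw [Metric.tendsto_nhds]
  intro η hη
  obtain ⟨δ, hδ, hball⟩ :=
    hec.exists_forall_eventually_abs_sub_lt f hf (ε := η / 8) (by positivity)
  obtain ⟨γ, hγ0, hγ1, hγ⟩ := hlb.exists_forall_eventually_le_dual hδ
  have he : ∀ ν₁ ν₂ : ProbabilityMeasure X, (∀ᵐ x ∂(ν₁ : Measure X), x ∈ Metric.ball z δ) →
      (∀ᵐ x ∂(ν₂ : Measure X), x ∈ Metric.ball z δ) → ∀ᶠ t in atTop,
      |∫ x, f x ∂(P.dual t ν₁ : Measure X) - ∫ x, f x ∂(P.dual t ν₂ : Measure X)| ≤ η / 2 := by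
    intro ν₁ ν₂ h₁ h₂
    have hη' : η / 8 < η / 4 := by linarith
    filter_upwards [eventually_abs_integral_dual_sub_le ν₁ f h₁ hball hη',
      eventually_abs_integral_dual_sub_le ν₂ f h₂ hball hη'] with t k₁ k₂
    rw [abs_le] at *
    constructor <;> linarith
  -- Iterating the coupling step from the trivial bound leaves the error `η / 2` of the good part
  -- plus a geometrically small remainder.
  have hiter : ∀ n : ℕ, ∀ ν₁ ν₂ : ProbabilityMeasure X, ∀ᶠ t in atTop,
      |∫ x, f x ∂(P.dual t ν₁ : Measure X) - ∫ x, f x ∂(P.dual t ν₂ : Measure X)|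
        ≤ η / 2 + (1 - γ) ^ n * (2 * ‖f‖) := by
    intro n
    induction n with
    | zero =>
      refine fun ν₁ ν₂ => .of_forall fun t => ?_
      have hb : ∀ ν : ProbabilityMeasure X, |∫ x, f x ∂(P.dual t ν : Measure X)| ≤ ‖f‖ := by
        intro ν
        simpa using norm_integral_le_of_norm_le_const (μ := (P.dual t ν : Measure X)) (f := f)
          (.of_forall fun y => f.norm_coe_le_norm y)
      have := (abs_sub _ _).trans (add_le_add (hb ν₁) (hb ν₂))
      linarith
    | succ n ih =>
      intro ν₁ ν₂
      filter_upwards [eventually_abs_integral_dual_sub_dual_le_step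
        Metric.isOpen_ball.measurableSet hγ0 hγ1 hγ he ih ν₁ ν₂] with t ht
      refine ht.trans_eq ?_
      ring
  have hlim : Tendsto (fun n : ℕ => η / 2 + (1 - γ : ℝ) ^ n * (2 * ‖f‖)) atTop
      (𝓝 (η / 2 + 0 * (2 * ‖f‖))) := by
    refine tendsto_const_nhds.add (Tendsto.mul_const _ ?_)
    have h0 : (0 : ℝ) < γ := by exact_mod_cast hγ0
    have h1 : (γ : ℝ) < 1 := by exact_mod_cast hγ1
    exact tendsto_pow_atTop_nhds_zero_of_lt_one (by linarith) (by linarith)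
  obtain ⟨n, hn⟩ := (hlim.eventually (eventually_lt_nhds (b := η) (by linarith))).exists
  filter_upwards [hiter n ν₁ ν₂] with t ht
  simpa using ht.trans_lt hn

end Coupling

/-! ### Stability of a given invariant measure -/

section Stability

variable {T X : Type*} [AddCommMonoid T] [LinearOrder T] [MetricSpace X] [MeasurableSpace X]
  [BorelSpace X] {P : MarkovFellerSemigroup T X} {z : X}

theorem IsInvariant.isAsymptoticallyStableWith [CanonicallyOrderedAdd T]
    [(atTop : Filter T).IsCountablyGenerated] {μ : ProbabilityMeasure X} (hμ : P.IsInvariant μ)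
    (hec : P.EventuallyContinuousAt z) (hlb : P.LowerBoundAt z) :
    P.IsAsymptoticallyStableWith μ := by
  have hconv : ∀ ν : ProbabilityMeasure X, Tendsto (fun t => P.dual t ν) atTop (𝓝 μ) := by
    intro ν
    rw [tendsto_iff_forall_lipschitz_integral_tendsto]
    rintro f ⟨C, hC⟩ ⟨K, hK⟩
    have := tendsto_integral_dual_sub_dual hec hlb (.mkOfBound ⟨f, hK.continuous⟩ C hC) ⟨K, hK⟩ ν μ
    simp only [hμ _] at this
    simpa using this.add_const (∫ x, f x ∂(μ : Measure X))
  refine ⟨hμ, fun μ' hμ' => ?_, hconv⟩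
  have h := hconv μ'
  simp only [hμ' _] at h
  exact tendsto_nhds_unique tendsto_const_nhds h

theorem IsAsymptoticallyStableWith.eventuallyContinuous {μ : ProbabilityMeasure X}
    (h : P.IsAsymptoticallyStableWith μ) : P.EventuallyContinuous := by
  intro z f _
  have hx : ∀ x, Tendsto (fun t => P.apply t f x) atTop (𝓝 (∫ y, f y ∂(μ : Measure X))) := by
    intro x
    have := ProbabilityMeasure.tendsto_iff_forall_integral_tendsto.1
      (h.2.2 (diracProba x)) f
    refine this.congr fun t => ?_
    rw [P.coe_dual_diracProba]
    rfl
  have h0 : ∀ x, limsup (fun t => |P.apply t f x - P.apply t f z|) atTop = 0 := by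
    intro x
    simpa using ((hx x).sub (hx z)).abs.limsup_eq
  simp only [h0]
  exact tendsto_const_nhds

theorem IsAsymptoticallyStableWith.lowerBoundAt {μ : ProbabilityMeasure X}
    (h : P.IsAsymptoticallyStableWith μ) (hz : z ∈ (μ : Measure X).support) :
    P.LowerBoundAt z := by
  intro ε hε
  refine ((Measure.mem_support_iff_forall z).1 hz _ (Metric.ball_mem_nhds z hε)).trans_le
    (le_iInf fun x => ?_)
  refine (ProbabilityMeasure.le_liminf_measure_open_of_tendsto
    (h.2.2 (diracProba x)) Metric.isOpen_ball).trans_eq ?_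
  congr 1
  ext1 t
  rw [P.coe_dual_diracProba]

end Stability

end MarkovFellerSemigroup

/-! ### Failure of tightness -/

section Tightness

variable {X : Type*} [MetricSpace X] [CompleteSpace X] [SecondCountableTopology X]
  [MeasurableSpace X] [BorelSpace X]

/-- In a complete space, a sequence of probability measures is tight as soon as, for every `ε > 0`,
the `ε`-neighbourhood of some compact set eventually carries all the mass up to `ε`. -/
theorem isTightMeasureSet_range_of_forall_thickening (ν : ℕ → ProbabilityMeasure X)
    (h : ∀ ε : ℝ, 0 < ε → ∃ C : Set X, IsCompact C ∧
      ∀ᶠ n in atTop, (ν n : Measure X) (Metric.thickening ε C)ᶜ ≤ ENNReal.ofReal ε) :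
    IsTightMeasureSet {((μ : ProbabilityMeasure X) : Measure X) | μ ∈ Set.range ν} := by
  have h' : ∀ ε : ℝ, 0 < ε → ∃ C : Set X, IsCompact C ∧
      ∀ n, (ν n : Measure X) (Metric.thickening ε C)ᶜ ≤ ENNReal.ofReal ε := by
    intro ε hε
    obtain ⟨C, hC, hn⟩ := h ε hε
    obtain ⟨N, hN⟩ := eventually_atTop.1 hn
    have hK : ∀ n, ∃ K : Set X, IsCompact K ∧ (ν n : Measure X) Kᶜ ≤ ENNReal.ofReal ε := by
      intro n
      obtain ⟨K, hK, hK'⟩ := isTightMeasureSet_iff_exists_isCompact_measure_compl_le.1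
        (isTightMeasureSet_singleton (μ := (ν n : Measure X))) _ (ENNReal.ofReal_pos.2 hε)
      exact ⟨K, hK, hK' _ rfl⟩
    choose K hKc hK using hK
    refine ⟨C ∪ ⋃ n ∈ Finset.range N, K n,
      hC.union ((Finset.range N).isCompact_biUnion fun n _ => hKc n), fun n => ?_⟩
    rcases le_or_gt N n with hn | hn
    · refine (measure_mono (Set.compl_subset_compl.2 ?_)).trans (hN n hn)
      exact Metric.thickening_subset_of_subset _ Set.subset_union_left
    · refine (measure_mono (Set.compl_subset_compl.2 ?_)).trans (hK n)
      refine Set.Subset.trans ?_ (Metric.self_subset_thickening hε _)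
      exact (Set.subset_biUnion_of_mem (u := K) (Finset.mem_coe.2 (Finset.mem_range.2 hn))).trans
        Set.subset_union_right
  rw [isTightMeasureSet_iff_exists_isCompact_measure_compl_le]
  intro ε hε
  -- The summable sequence `e` serves both as masses and as radii.
  obtain ⟨e, he0, he⟩ := ENNReal.exists_pos_sum_of_countable hε.ne' ℕ
  have hlim : Tendsto e atTop (𝓝 0) :=
    NNReal.tendsto_atTop_zero_of_summable (ENNReal.tsum_coe_ne_top_iff_summable.1 (ne_top_of_lt he))
  choose C hCc hC using fun m => h' (e m) (he0 m)
  refine ⟨⋂ m, Metric.cthickening (e m) (C m), ?_, ?_⟩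
  · refine isCompact_iff_totallyBounded_isComplete.2 ⟨?_,
      (isClosed_iInter fun m => Metric.isClosed_cthickening).isComplete⟩
    rw [Metric.totallyBounded_iff]
    intro r hr
    obtain ⟨m, hm⟩ := (hlim.eventually (eventually_lt_nhds (b := (r / 2).toNNReal)
      (by simpa using hr))).exists
    have hm' : (e m : ℝ) < r / 2 := by
      rwa [← NNReal.coe_lt_coe, Real.coe_toNNReal _ (by positivity)] at hm
    obtain ⟨t, ht, hCt⟩ :=
      Metric.totallyBounded_iff.1 (hCc m).totallyBounded (r / 2) (by positivity)
    refine ⟨t, ht, fun x hx => ?_⟩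
    have hx' := Metric.cthickening_subset_thickening' (half_pos hr) hm' _ (Set.mem_iInter.1 hx m)
    obtain ⟨y, hy, hxy⟩ := Metric.mem_thickening_iff.1 hx'
    obtain ⟨w, hw, hyw⟩ := Set.mem_iUnion₂.1 (hCt hy)
    refine Set.mem_iUnion₂.2 ⟨w, hw, ?_⟩
    rw [Metric.mem_ball] at *
    linarith [dist_triangle x y w]
  · rintro _ ⟨_, ⟨n, rfl⟩, rfl⟩
    rw [Set.compl_iInter]
    refine (measure_iUnion_le _).trans (le_trans (ENNReal.tsum_le_tsum fun m => ?_) he.le)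
    refine (measure_mono (Set.compl_subset_compl.2
      (Metric.thickening_subset_cthickening _ _))).trans ((hC m n).trans ?_)
    simp

/-- A sequence of probability measures that is not tight leaves a fixed amount of mass on
uniformly separated compact sets. -/
theorem exists_separated_compacts_of_not_isTightMeasureSet (ν : ℕ → ProbabilityMeasure X)
    (h : ¬ IsTightMeasureSet {((μ : ProbabilityMeasure X) : Measure X) | μ ∈ Set.range ν}) :
    ∃ ε > 0, ∃ φ : ℕ → ℕ, StrictMono φ ∧ ∃ K : ℕ → Set X, (∀ i, IsCompact (K i)) ∧
      (∀ i, ε ≤ (ν (φ i) : Measure X).real (K i)) ∧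
      Pairwise fun i j => ∀ x ∈ K i, ∀ y ∈ K j, ε ≤ dist x y := by
  have h' := mt (isTightMeasureSet_range_of_forall_thickening ν) h
  push Not at h'
  obtain ⟨ε, hε, H⟩ := h'
  obtain ⟨f, hf, hf'⟩ := exists_seq_of_forall_finset_exists
    (fun p : ℕ × Set X => IsCompact p.2 ∧ ENNReal.ofReal ε < (ν p.1 : Measure X) p.2)
    (fun p p' => p.1 < p'.1 ∧ ∀ x ∈ p.2, ∀ y ∈ p'.2, ε ≤ dist x y) (by
      intro s hs
      have hC : IsCompact (⋃ p ∈ s, p.2) := s.isCompact_biUnion fun p hp => (hs p hp).1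
      obtain ⟨n, hn, hlt⟩ := frequently_atTop.1 (H _ hC) (s.sup Prod.fst + 1)
      obtain ⟨K, hKsub, hK, hlt'⟩ :=
        Metric.isOpen_thickening.measurableSet.compl.exists_lt_isCompact_of_ne_top
          (measure_ne_top _ _) hlt
      refine ⟨(n, K), ⟨hK, hlt'⟩, fun p hp => ⟨?_, fun x hx y hy => ?_⟩⟩
      · exact (Finset.le_sup (f := Prod.fst) hp).trans_lt (Nat.lt_of_succ_le hn)
      · by_contra! hlt
        refine hKsub hy (Metric.mem_thickening_iff.2 ⟨x, Set.mem_biUnion hp hx, ?_⟩)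
        rwa [dist_comm])
  refine ⟨ε, hε, fun i => (f i).1, fun i j hij => (hf' i j hij).1, fun i => (f i).2,
    fun i => (hf i).1, fun i => ?_, fun i j hij => ?_⟩
  · exact (ENNReal.ofReal_le_iff_le_toReal (measure_ne_top _ _)).1 (hf i).2.le
  · rcases hij.lt_or_gt with hij | hij
    · exact (hf' i j hij).2
    · intro x hx y hy
      rw [dist_comm]
      exact (hf' j i hij).2 y hy x hx

end Tightness

/-! ### Bump functions of unions of separated sets -/

section Bump

/-- The union of the sets `K i` over the indices `i` selected by `I`. -/
def selectedUnion {X : Type*} (K : ℕ → Set X) (I : ℕ → Bool) : Set X :=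
  ⋃ i ∈ {i | I i = true}, K i

theorem selectedUnion_update_true {X : Type*} (K : ℕ → Set X) (I : ℕ → Bool) (i : ℕ) :
    selectedUnion K (Function.update I i true) =
      selectedUnion K (Function.update I i false) ∪ K i := by
  ext x
  simp only [selectedUnion, Set.mem_iUnion, Set.mem_union, Set.mem_ofPred_eq, exists_prop]
  constructor
  · rintro ⟨j, hj, hx⟩
    rcases eq_or_ne j i with rfl | hji
    · exact .inr hx
    · refine .inl ⟨j, ?_, hx⟩
      rwa [Function.update_of_ne hji] at hj ⊢
  · rintro (⟨j, hj, hx⟩ | hx)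
    · rcases eq_or_ne j i with rfl | hji
      · simp at hj
      · refine ⟨j, ?_, hx⟩
        rwa [Function.update_of_ne hji] at hj ⊢
    · exact ⟨i, by simp, hx⟩

variable {X : Type*} [MetricSpace X] {δ : ℝ}

/-- The Lipschitz function equal to `1` on `E` and to `0` off the `δ`-neighbourhood of `E`, as a
real-valued bounded continuous function. It is identically `0` when `E` is empty. -/
noncomputable def bump (hδ : 0 < δ) (E : Set X) : X →ᵇ ℝ :=
  .ofNormedAddCommGroup (fun x => (thickenedIndicator hδ E x : ℝ)) (by fun_prop) 1 fun x => by
    simpa using thickenedIndicator_le_one hδ E x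

variable (hδ : 0 < δ) {E F : Set X} {x : X}

theorem bump_nonneg (E : Set X) (x : X) : 0 ≤ bump hδ E x :=
  NNReal.coe_nonneg _

theorem bump_le_one (E : Set X) (x : X) : bump hδ E x ≤ 1 :=
  NNReal.coe_le_one.2 (thickenedIndicator_le_one hδ E x)

theorem bump_eq_one (hx : x ∈ E) : bump hδ E x = 1 :=
  congrArg NNReal.toReal (thickenedIndicator_one hδ E hx)

theorem bump_eq_zero (hx : x ∉ Metric.thickening δ E) : bump hδ E x = 0 :=
  congrArg NNReal.toReal (thickenedIndicator_zero hδ E hx)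

theorem bump_mono (h : E ⊆ F) (x : X) : bump hδ E x ≤ bump hδ F x :=
  NNReal.coe_le_coe.2 (thickenedIndicator_subset hδ h x)

theorem bump_union_le (E F : Set X) (x : X) :
    bump hδ (E ∪ F) x ≤ bump hδ E x + bump hδ F x := by
  have h : bump hδ (E ∪ F) x = bump hδ E x ∨ bump hδ (E ∪ F) x = bump hδ F x := by
    simp only [bump, BoundedContinuousFunction.coe_ofNormedAddCommGroup,
      thickenedIndicator.coeFn_eq_comp, Function.comp_apply, thickenedIndicatorAux,
      Metric.infEDist_union]
    rcases min_choice (Metric.infEDist x E) (Metric.infEDist x F) with h | h <;> simp [h]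
  have hE := bump_nonneg hδ E x
  have hF := bump_nonneg hδ F x
  rcases h with h | h <;> linarith

theorem exists_lipschitzWith_bump (E : Set X) : ∃ K, LipschitzWith K (bump hδ E) :=
  ⟨_, (lipschitzWith_thickenedIndicator hδ E)⟩

variable {K : ℕ → Set X}

theorem disjoint_thickening_of_separated {E F : Set X}
    (h : ∀ x ∈ E, ∀ y ∈ F, δ + δ ≤ dist x y) :
    Disjoint (Metric.thickening δ E) (Metric.thickening δ F) := by
  rw [Set.disjoint_left]
  intro x hE hF
  obtain ⟨y, hy, hxy⟩ := Metric.mem_thickening_iff.1 hE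
  obtain ⟨w, hw, hxw⟩ := Metric.mem_thickening_iff.1 hF
  linarith [h y hy w hw, dist_triangle_left y w x]

theorem notMem_thickening_selectedUnion
    (hK : Pairwise fun i j => ∀ x ∈ K i, ∀ y ∈ K j, δ + δ ≤ dist x y) {i : ℕ}
    (hx : x ∈ Metric.thickening δ (K i)) {I : ℕ → Bool} (hI : I i = false) :
    x ∉ Metric.thickening δ (selectedUnion K I) := by
  intro hx'
  simp only [selectedUnion, Metric.thickening_iUnion, Set.mem_iUnion] at hx'
  obtain ⟨j, hj, hxj⟩ := hx'
  have hij : i ≠ j := by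
    rintro rfl
    simp [hI] at hj
  exact Set.disjoint_left.1 (disjoint_thickening_of_separated (hK hij)) hx hxj

/-- When the sets `K i` are separated, a given point `x` is close to at most one of them, so that
the bump function of a selected union takes at `x` a value depending on one bit of the selection. -/
theorem exists_bump_selectedUnion_eq
    (hK : Pairwise fun i j => ∀ x ∈ K i, ∀ y ∈ K j, δ + δ ≤ dist x y) (x : X) :
    ∃ i, ∀ I : ℕ → Bool,
      bump hδ (selectedUnion K I) x = bump hδ (selectedUnion K fun _ => I i) x := by
  by_cases hx : ∃ i, x ∈ Metric.thickening δ (K i)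
  · obtain ⟨i, hi⟩ := hx
    have hval : ∀ I : ℕ → Bool, I i = true →
        bump hδ (selectedUnion K I) x = bump hδ (K i) x := by
      intro I hI
      have hI' : Function.update I i true = I := by rw [← hI, Function.update_eq_self]
      refine le_antisymm ?_ (bump_mono hδ (Set.subset_biUnion_of_mem (u := K) hI) x)
      have h0 := bump_eq_zero hδ (notMem_thickening_selectedUnion hK hi
        (I := Function.update I i false) (by simp))
      have h := bump_union_le hδ (selectedUnion K (Function.update I i false)) (K i) x
      rwa [← selectedUnion_update_true, hI', h0, zero_add] at h
    refine ⟨i, fun I => ?_⟩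
    cases hI : I i with
    | true => rw [hval _ hI, hval _ rfl]
    | false =>
      rw [bump_eq_zero hδ (notMem_thickening_selectedUnion hK hi hI),
        bump_eq_zero hδ (notMem_thickening_selectedUnion hK hi rfl)]
  · have h0 : ∀ I : ℕ → Bool, bump hδ (selectedUnion K I) x = 0 := by
      refine fun I => bump_eq_zero hδ fun h => hx ?_
      simp only [selectedUnion, Metric.thickening_iUnion, Set.mem_iUnion] at h
      obtain ⟨j, -, hj⟩ := h
      exact ⟨j, hj⟩
    exact ⟨0, fun I => by rw [h0, h0]⟩

theorem sum_bump_le_one (hK : Pairwise fun i j => ∀ x ∈ K i, ∀ y ∈ K j, δ + δ ≤ dist x y)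
    (s : Finset ℕ) (x : X) : ∑ i ∈ s, bump hδ (K i) x ≤ 1 := by
  by_cases hx : ∃ i ∈ s, x ∈ Metric.thickening δ (K i)
  · obtain ⟨i, his, hi⟩ := hx
    rw [Finset.sum_eq_single_of_mem i his fun j _ hji => bump_eq_zero hδ fun hj =>
      Set.disjoint_left.1 (disjoint_thickening_of_separated (hK hji)) hj hi]
    exact bump_le_one hδ _ x
  · rw [Finset.sum_eq_zero fun i hi => bump_eq_zero hδ fun h => hx ⟨i, hi, h⟩]
    exact zero_le_one

variable [MeasurableSpace X] [BorelSpace X]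

theorem continuous_integral_bump_selectedUnion
    (hK : Pairwise fun i j => ∀ x ∈ K i, ∀ y ∈ K j, δ + δ ≤ dist x y)
    (μ : ProbabilityMeasure X) :
    Continuous fun I : ℕ → Bool => ∫ x, bump hδ (selectedUnion K I) x ∂(μ : Measure X) := by
  refine continuous_of_dominated (bound := fun _ => 1)
    (fun I => (bump hδ _).continuous.measurable.aestronglyMeasurable)
    (fun I => .of_forall fun x => ?_) (integrable_const _) (.of_forall fun x => ?_)
  · rw [Real.norm_eq_abs, abs_of_nonneg (bump_nonneg hδ _ x)]
    exact bump_le_one hδ _ x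
  · obtain ⟨i, hi⟩ := exists_bump_selectedUnion_eq hδ hK x
    rw [funext hi]
    exact (continuous_of_discreteTopology
      (f := fun b : Bool => bump hδ (selectedUnion K fun _ => b) x)).comp (continuous_apply i)

/-- A form of the Schur property of `ℓ¹`: if `μ n` and `ν n` merge on the bump functions of all
unions of the separated sets `K i`, and `ν n` gives `K n` mass at least `ε`, then `μ n` gives a
neighbourhood of `K n` mass at least `ε / 2`. By Baire's theorem on the Cantor space of selections,
the merging is uniform on a cylinder, and such a cylinder contains, for all large `n`, two
selections that differ in the index `n` only. -/
theorem eventually_le_integral_bump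
    (hK : Pairwise fun i j => ∀ x ∈ K i, ∀ y ∈ K j, δ + δ ≤ dist x y)
    (hKm : ∀ i, MeasurableSet (K i)) (μ ν : ℕ → ProbabilityMeasure X)
    (h : ∀ I : ℕ → Bool, Tendsto (fun n => ∫ x, bump hδ (selectedUnion K I) x ∂(μ n : Measure X) -
      ∫ x, bump hδ (selectedUnion K I) x ∂(ν n : Measure X)) atTop (𝓝 0))
    {ε : ℝ} (hε : 0 < ε) (hν : ∀ n, ε ≤ (ν n : Measure X).real (K n)) :
    ∀ᶠ n in atTop, ε / 2 ≤ ∫ x, bump hδ (K n) x ∂(μ n : Measure X) := by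
  let S : ℕ → Set (ℕ → Bool) := fun N => ⋂ n ∈ Set.Ici N,
    {I | |∫ x, bump hδ (selectedUnion K I) x ∂(μ n : Measure X) -
      ∫ x, bump hδ (selectedUnion K I) x ∂(ν n : Measure X)| ≤ ε / 4}
  have hS : ∀ N, IsClosed (S N) := fun N => isClosed_biInter fun n _ =>
    isClosed_le ((continuous_integral_bump_selectedUnion hδ hK (μ n)).sub
      (continuous_integral_bump_selectedUnion hδ hK (ν n))).abs continuous_const
  have hSU : ⋃ N, S N = Set.univ := by
    refine Set.eq_univ_of_forall fun I => ?_
    obtain ⟨N, hN⟩ := Metric.tendsto_atTop.1 (h I) (ε / 4) (by positivity)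
    refine Set.mem_iUnion.2 ⟨N, Set.mem_iInter₂.2 fun n hn => ?_⟩
    simpa using (hN n hn).le
  obtain ⟨N, I, hI⟩ := nonempty_interior_of_iUnion_of_closed hS hSU
  have hupd : ∀ b : Bool, ∀ᶠ n in atTop, Function.update I n b ∈ S N := by
    intro b
    have : Tendsto (fun n => Function.update I n b) atTop (𝓝 I) := by
      refine tendsto_pi_nhds.2 fun i => tendsto_const_nhds.congr' ?_
      filter_upwards [eventually_gt_atTop i] with n hn
      rw [Function.update_of_ne hn.ne]
    exact this.eventually (mem_interior_iff_mem_nhds.1 hI)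
  filter_upwards [hupd true, hupd false, eventually_ge_atTop N] with n h₁ h₀ hn
  have k₁ := Set.mem_iInter₂.1 h₁ n hn
  have k₀ := Set.mem_iInter₂.1 h₀ n hn
  simp only [Set.mem_ofPred_eq, abs_le] at k₁ k₀
  set E₁ := selectedUnion K (Function.update I n true) with hE₁
  set E₀ := selectedUnion K (Function.update I n false) with hE₀
  have hE : E₁ = E₀ ∪ K n := selectedUnion_update_true K I n
  have hint : ∀ (m : ProbabilityMeasure X) (E : Set X),
      Integrable (bump hδ E) (m : Measure X) := fun m E => (bump hδ E).integrable _
  have hlow : (ν n : Measure X).real (K n) ≤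
      ∫ x, bump hδ E₁ x ∂(ν n : Measure X) - ∫ x, bump hδ E₀ x ∂(ν n : Measure X) := by
    rw [← integral_sub (hint _ _) (hint _ _), ← integral_indicator_one (hKm n)]
    refine integral_mono ((integrable_const 1).indicator (hKm n))
      ((hint _ _).sub (hint _ _)) fun x => ?_
    by_cases hx : x ∈ K n
    · have h0 := bump_eq_zero hδ (notMem_thickening_selectedUnion hK
        (Metric.self_subset_thickening hδ _ hx) (I := Function.update I n false) (by simp))
      have h1 : bump hδ E₁ x = 1 := bump_eq_one hδ (hE ▸ Set.mem_union_right _ hx)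
      simp [hx, h0, h1, hE₀]
    · simpa [hx] using bump_mono hδ (hE ▸ Set.subset_union_left) x
  have hup : ∫ x, bump hδ E₁ x ∂(μ n : Measure X) ≤
      ∫ x, bump hδ E₀ x ∂(μ n : Measure X) + ∫ x, bump hδ (K n) x ∂(μ n : Measure X) := by
    rw [← integral_add (hint _ _) (hint _ _), hE]
    exact integral_mono (hint _ _) ((hint _ _).add (hint _ _)) fun x => bump_union_le hδ _ _ x
  linarith [hν n]

end Bump

namespace MarkovFellerSemigroup

/-! ### Existence of an invariant measure -/

section Reachable

variable {T X : Type*} [AddMonoid T] [MetricSpace X] [MeasurableSpace X]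
  {P : MarkovFellerSemigroup T X} {z : X}

/-- The points all of whose neighbourhoods can be reached from `z`. -/
def reachable (P : MarkovFellerSemigroup T X) (z : X) : Set X :=
  {w | ∀ V, IsOpen V → w ∈ V → ∃ t, 0 < P.kernel t z V}

theorem self_mem_reachable [BorelSpace X] : z ∈ P.reachable z := by
  intro V hV hz
  refine ⟨0, ?_⟩
  rw [P.kernel_zero, Kernel.id_apply, Measure.dirac_apply' _ hV.measurableSet]
  simp [hz]

theorem isClosed_reachable : IsClosed (P.reachable z) := by
  refine isClosed_of_closure_subset fun w hw V hV hwV => ?_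
  obtain ⟨y, hyV, hy⟩ := mem_closure_iff.1 hw V hV hwV
  exact hy V hV hyV

theorem ae_mem_reachable [SecondCountableTopology X] (t : T) :
    ∀ᵐ x ∂(P.kernel t z), x ∈ P.reachable z := by
  refine measure_null_of_locally_null _ fun x hx => ?_
  simp only [reachable, Set.mem_compl_iff, Set.mem_ofPred_eq, not_forall, not_exists, not_lt,
    nonpos_iff_eq_zero] at hx
  obtain ⟨V, hV, hxV, h0⟩ := hx
  exact ⟨V, mem_nhdsWithin_of_mem_nhds (hV.mem_nhds hxV), h0 t⟩

end Reachable

section Existence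

variable {T X : Type*} [MetricSpace X] [MeasurableSpace X] [BorelSpace X]

theorem isOpen_setOf_lt_kernel [AddMonoid T] (P : MarkovFellerSemigroup T X) (t : T) {V : Set X}
    (hV : IsOpen V) (a : ℝ≥0∞) : IsOpen {x | a < P.kernel t x V} := by
  refine isOpen_iff_mem_nhds.2 fun x (hx : a < P.kernel t x V) => ?_
  have hlim : Tendsto (fun y => P.dual t (diracProba y)) (𝓝 x) (𝓝 (P.dual t (diracProba x))) := by
    refine ProbabilityMeasure.tendsto_iff_forall_integral_tendsto.2 fun f => ?_
    simp only [coe_dual_diracProba]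
    exact (P.continuous_apply t f).tendsto x
  have h := ProbabilityMeasure.le_liminf_measure_open_of_tendsto hlim hV
  simp only [coe_dual_diracProba] at h
  exact eventually_lt_of_lt_liminf (hx.trans_le h)

variable [AddCommMonoid T] [LinearOrder T] [CanonicallyOrderedAdd T]
  {P : MarkovFellerSemigroup T X} {z : X}

/-- Under the lower bound at `z`, an open set that can be reached from `z` keeps a fixed amount of
mass at all large times: by the Feller property it is reached with a uniform probability from a
whole neighbourhood of `z`, to which the process returns. -/
theorem LowerBoundAt.exists_eventually_le_kernel (hlb : P.LowerBoundAt z) {V : Set X}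
    (hV : IsOpen V) {s : T} (hs : 0 < P.kernel s z V) :
    ∃ γ : ℝ≥0, 0 < γ ∧ ∀ᶠ t in atTop, (γ : ℝ≥0∞) ≤ P.kernel t z V := by
  obtain ⟨a, ha0, ha⟩ := ENNReal.lt_iff_exists_nnreal_btwn.1 hs
  obtain ⟨δ, hδ, hball⟩ := Metric.isOpen_iff.1 (P.isOpen_setOf_lt_kernel s hV a) z ha
  obtain ⟨γ, hγ0, -, hγ⟩ := hlb.exists_forall_eventually_le hδ
  refine ⟨a * γ, mul_pos (by exact_mod_cast ha0) hγ0, ?_⟩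
  filter_upwards [eventually_exists_eq_add (hγ z) s] with τ hτ
  obtain ⟨t, rfl, ht⟩ := hτ
  rw [add_comm, P.kernel_add_apply _ _ _ hV.measurableSet]
  calc ((a * γ : ℝ≥0) : ℝ≥0∞) ≤ a * P.kernel t z (Metric.ball z δ) := by
        rw [ENNReal.coe_mul]; gcongr
    _ = ∫⁻ _ in Metric.ball z δ, a ∂(P.kernel t z) := by simp
    _ ≤ ∫⁻ y in Metric.ball z δ, P.kernel s y V ∂(P.kernel t z) :=
        setLIntegral_mono ((P.kernel s).measurable_coe hV.measurableSet) fun y hy => (hball hy).le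
    _ ≤ ∫⁻ y, P.kernel s y V ∂(P.kernel t z) := setLIntegral_le_lintegral _ _

variable [CompleteSpace X] [SecondCountableTopology X] [(atTop : Filter T).IsCountablyGenerated]

/-- The orbit of `z` is tight along every sequence of times tending to infinity. Otherwise it
leaves mass `ε` at times `q i` on separated compact sets `K i`. As all orbits merge, each point
sends mass `ε / 2` to the neighbourhood of `K i` at time `q i` for large `i`, and Baire's theorem
on the closed set of reachable points makes this uniform on an open set `V`. Since the orbit of `z`
has a fixed amount of mass in `V` at all large times, at one and the same late time it has a fixed
amount of mass near each of arbitrarily many of the sets `K i`. -/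
theorem isTightMeasureSet_range_dual (hec : P.EventuallyContinuousAt z) (hlb : P.LowerBoundAt z)
    {t : ℕ → T} (ht : Tendsto t atTop atTop) :
    IsTightMeasureSet {((μ : ProbabilityMeasure X) : Measure X) |
      μ ∈ Set.range fun n => P.dual (t n) (diracProba z)} := by
  by_contra hnot
  obtain ⟨ε, hε, φ, hφ, K, hKc, hKε, hKsep⟩ :=
    exists_separated_compacts_of_not_isTightMeasureSet _ hnot
  -- Bumps of radius `ε / 2` around the `ε`-separated sets have disjoint supports.
  have hδ : 0 < ε / 2 := half_pos hε
  replace hKsep : Pairwise fun i j => ∀ x ∈ K i, ∀ y ∈ K j, ε / 2 + ε / 2 ≤ dist x y :=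
    fun i j hij x hx y hy => (add_halves ε).trans_le (hKsep hij x hx y hy)
  have hq : Tendsto (t ∘ φ) atTop atTop := ht.comp hφ.tendsto_atTop
  set q : ℕ → T := t ∘ φ
  have hpt : ∀ x, ∀ᶠ n in atTop, ε / 2 ≤ P.apply (q n) (bump hδ (K n)) x := by
    intro x
    have h := eventually_le_integral_bump hδ hKsep (fun i => (hKc i).measurableSet)
      (fun n => P.dual (q n) (diracProba x)) (fun n => P.dual (q n) (diracProba z))
      (fun I => (tendsto_integral_dual_sub_dual hec hlb (bump hδ (selectedUnion K I))
        (exists_lipschitzWith_bump hδ _) (diracProba x) (diracProba z)).comp hq) hε hKε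
    simpa only [coe_dual_diracProba] using! h
  have : CompleteSpace (P.reachable z) := isClosed_reachable.completeSpace_coe
  have : Nonempty (P.reachable z) := ⟨⟨z, self_mem_reachable⟩⟩
  let C : ℕ → Set (P.reachable z) := fun N => ⋂ n ∈ Set.Ici N,
    {w | ε / 2 ≤ P.apply (q n) (bump hδ (K n)) w}
  have hC : ∀ N, IsClosed (C N) := fun N => isClosed_biInter fun n _ =>
    isClosed_le continuous_const ((P.continuous_apply _ _).comp continuous_subtype_val)
  have hCU : ⋃ N, C N = Set.univ := by
    refine Set.eq_univ_of_forall fun w => ?_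
    obtain ⟨N, hN⟩ := eventually_atTop.1 (hpt w)
    exact Set.mem_iUnion.2 ⟨N, Set.mem_iInter₂.2 fun n hn => hN n hn⟩
  obtain ⟨N, w, hw⟩ := nonempty_interior_of_iUnion_of_closed hC hCU
  obtain ⟨V, hV, hVC⟩ := isOpen_induced_iff.1 (isOpen_interior (s := C N))
  have hVN : ∀ x ∈ V, x ∈ P.reachable z → ∀ n, N ≤ n →
      ε / 2 ≤ P.apply (q n) (bump hδ (K n)) x := by
    intro x hxV hx n hn
    have hxi : (⟨x, hx⟩ : P.reachable z) ∈ interior (C N) := by rw [← hVC]; exact hxV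
    exact Set.mem_iInter₂.1 (interior_subset hxi) n hn
  have hwV : (w : X) ∈ V := by rw [← hVC] at hw; exact hw
  obtain ⟨s, hs⟩ := w.2 V hV hwV
  obtain ⟨γ, hγ0, hγ⟩ := hlb.exists_eventually_le_kernel hV hs
  have hmass : ∀ n, N ≤ n → ∀ᶠ τ in atTop, ε / 2 * γ ≤ P.apply τ (bump hδ (K n)) z := by
    intro n hn
    filter_upwards [eventually_exists_eq_add hγ (q n)] with τ hτ
    obtain ⟨s, rfl, hs⟩ := hτ
    have hs' : (γ : ℝ) ≤ (P.kernel s z).real V :=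
      ENNReal.toReal_mono (measure_ne_top _ _) hs
    rw [add_comm, P.apply_add]
    calc ε / 2 * γ ≤ ε / 2 * (P.kernel s z).real V := by gcongr
      _ = ∫ y, V.indicator (fun _ => ε / 2) y ∂(P.kernel s z) := by
          rw [integral_indicator_const _ hV.measurableSet, smul_eq_mul, mul_comm]
      _ ≤ ∫ y, P.apply (q n) (bump hδ (K n)) y ∂(P.kernel s z) := by
          refine integral_mono_ae ((integrable_const _).indicator hV.measurableSet)
            (.of_bound (P.continuous_apply _ _).aestronglyMeasurable _
              (.of_forall fun x => P.abs_apply_le _ _ x)) ?_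
          filter_upwards [ae_mem_reachable s] with y hy
          by_cases hyV : y ∈ V
          · simpa [hyV] using hVN y hyV hy n hn
          · simpa [hyV] using! integral_nonneg fun u => bump_nonneg hδ (K n) u
  have hc : 0 < ε / 2 * γ := mul_pos hδ (by exact_mod_cast hγ0)
  -- `M` bumps, each with integral at least `ε / 2 * γ`, already exceed the total mass.
  obtain ⟨M, hM⟩ := exists_nat_gt (1 / (ε / 2 * γ))
  have hall : ∀ᶠ τ in atTop, ∀ n ∈ Finset.Ico N (N + M),
      ε / 2 * γ ≤ P.apply τ (bump hδ (K n)) z :=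
    (Finset.eventually_all _).2 fun n hn => hmass n (Finset.mem_Ico.1 hn).1
  obtain ⟨τ, hτ⟩ := hall.exists
  have hsum : ∑ n ∈ Finset.Ico N (N + M), P.apply τ (bump hδ (K n)) z ≤ 1 := by
    simp only [apply]
    rw [← integral_finsetSum _ fun n _ => (bump hδ (K n)).integrable _]
    calc _ ≤ ∫ _, (1 : ℝ) ∂(P.kernel τ z) :=
          integral_mono (integrable_finsetSum _ fun n _ => (bump hδ (K n)).integrable _)
            (integrable_const _) fun x => sum_bump_le_one hδ hKsep _ x
      _ = 1 := by simp
  have h := (Finset.card_nsmul_le_sum _ _ _ hτ).trans hsum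
  rw [Nat.card_Ico, add_tsub_cancel_left, nsmul_eq_mul] at h
  rw [div_lt_iff₀ hc] at hM
  linarith

/-- A weak limit point `μ` of the orbit of `z` is invariant: `P_s (P_{t n} δ_z)` converges to
`P_s μ` by the Feller property, and to `μ` because it merges with `P_{t n} δ_z`. -/
theorem exists_isInvariant (hec : P.EventuallyContinuousAt z) (hlb : P.LowerBoundAt z) :
    ∃ μ : ProbabilityMeasure X, P.IsInvariant μ := by
  obtain ⟨t, ht⟩ := exists_seq_tendsto (atTop : Filter T)
  obtain ⟨μ, -, φ, hφ, hμ⟩ :=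
    (isCompact_closure_of_isTightMeasureSet (isTightMeasureSet_range_dual hec hlb ht)).isSeqCompact
      fun n => subset_closure (Set.mem_range_self n)
  refine ⟨μ, fun s => ?_⟩
  have hcomm : ∀ r, P.dual r (P.dual s (diracProba z)) = P.dual s (P.dual r (diracProba z)) :=
    fun r => by rw [← P.dual_add, ← P.dual_add, add_comm]
  have h₁ : Tendsto (fun n => P.dual s (P.dual (t (φ n)) (diracProba z))) atTop
      (𝓝 (P.dual s μ)) := by
    refine ProbabilityMeasure.tendsto_iff_forall_integral_tendsto.2 fun f => ?_
    simp only [P.integral_dual s]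
    exact ProbabilityMeasure.tendsto_iff_forall_integral_tendsto.1 hμ
      (.ofNormedAddCommGroup _ (P.continuous_apply s f) ‖f‖ (P.abs_apply_le s f))
  have h₂ : Tendsto (fun n => P.dual s (P.dual (t (φ n)) (diracProba z))) atTop (𝓝 μ) := by
    rw [tendsto_iff_forall_lipschitz_integral_tendsto] at hμ ⊢
    rintro f ⟨C, hC⟩ ⟨L, hL⟩
    have h := (tendsto_integral_dual_sub_dual hec hlb (.mkOfBound ⟨f, hL.continuous⟩ C hC) ⟨L, hL⟩
      (P.dual s (diracProba z)) (diracProba z)).comp (ht.comp hφ.tendsto_atTop)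
    simpa [hcomm] using h.add (hμ f ⟨C, hC⟩ ⟨L, hL⟩)
  exact tendsto_nhds_unique h₁ h₂

end Existence

/-! ### The equivalence for a general set of times -/

section Equivalence

variable {T X : Type*} [AddCommMonoid T] [LinearOrder T] [CanonicallyOrderedAdd T]
  [(atTop : Filter T).IsCountablyGenerated] [MetricSpace X]
  [SecondCountableTopology X] [MeasurableSpace X] [BorelSpace X]

theorem isAsymptoticallyStableWith_iff (P : MarkovFellerSemigroup T X) (μ : ProbabilityMeasure X) :
    P.IsAsymptoticallyStableWith μ ↔ P.EventuallyContinuous ∧ P.IsInvariant μ ∧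
      ∀ z ∈ (μ : Measure X).support, P.LowerBoundAt z := by
  refine ⟨fun h => ⟨h.eventuallyContinuous, h.1, fun z hz => h.lowerBoundAt hz⟩, ?_⟩
  rintro ⟨hec, hμ, hlb⟩
  obtain ⟨z, hz⟩ := Measure.nonempty_support (IsProbabilityMeasure.ne_zero (μ : Measure X))
  exact hμ.isAsymptoticallyStableWith (hec z) (hlb z hz)

theorem isAsymptoticallyStable_tfae [CompleteSpace X] (P : MarkovFellerSemigroup T X) :
    [P.IsAsymptoticallyStable,
      P.EventuallyContinuous ∧ ∃ μ : ProbabilityMeasure X, P.IsInvariant μ ∧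
        ∀ z ∈ (μ : Measure X).support, P.LowerBoundAt z,
      P.EventuallyContinuous ∧ ∃ z : X, P.LowerBoundAt z].TFAE := by
  tfae_have 1 → 2
  | ⟨μ, hμ⟩ => by
    obtain ⟨hec, h⟩ := (P.isAsymptoticallyStableWith_iff μ).1 hμ
    exact ⟨hec, μ, h⟩
  tfae_have 2 → 3
  | ⟨hec, μ, _, hlb⟩ => by
    obtain ⟨z, hz⟩ := Measure.nonempty_support (IsProbabilityMeasure.ne_zero (μ : Measure X))
    exact ⟨hec, z, hlb z hz⟩
  tfae_have 3 → 1
  | ⟨hec, z, hlb⟩ => by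
    obtain ⟨μ, hμ⟩ := exists_isInvariant (hec z) hlb
    exact ⟨μ, hμ.isAsymptoticallyStableWith (hec z) hlb⟩
  tfae_finish

end Equivalence

end MarkovFellerSemigroup

theorem theorem1 {X : Type*} [MetricSpace X] [CompleteSpace X] [SecondCountableTopology X]
    [MeasurableSpace X] [BorelSpace X] :
    -- continuous time
    (∀ P : MarkovFellerSemigroup ℝ≥0 X,
      [P.IsAsymptoticallyStable,
        P.EventuallyContinuous ∧ ∃ μ : ProbabilityMeasure X, P.IsInvariant μ ∧
          ∀ z ∈ (μ : Measure X).support, P.LowerBoundAt z,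
        P.EventuallyContinuous ∧ ∃ z : X, P.LowerBoundAt z].TFAE ∧
      ∀ μ : ProbabilityMeasure X, P.IsAsymptoticallyStableWith μ ↔
        P.EventuallyContinuous ∧ P.IsInvariant μ ∧
          ∀ z ∈ (μ : Measure X).support, P.LowerBoundAt z) ∧
    -- discrete time
    (∀ P : MarkovFellerSemigroup ℕ X,
      [P.IsAsymptoticallyStable,
        P.EventuallyContinuous ∧ ∃ μ : ProbabilityMeasure X, P.IsInvariant μ ∧
          ∀ z ∈ (μ : Measure X).support, P.LowerBoundAt z,
        P.EventuallyContinuous ∧ ∃ z : X, P.LowerBoundAt z].TFAE ∧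
      ∀ μ : ProbabilityMeasure X, P.IsAsymptoticallyStableWith μ ↔
        P.EventuallyContinuous ∧ P.IsInvariant μ ∧
          ∀ z ∈ (μ : Measure X).support, P.LowerBoundAt z) := by
  exact ⟨fun P => ⟨P.isAsymptoticallyStable_tfae, P.isAsymptoticallyStableWith_iff⟩,
    fun P => ⟨P.isAsymptoticallyStable_tfae, P.isAsymptoticallyStableWith_iff⟩⟩
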